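/- \textbf{Conventions.} Fix a first-order signature; $n\ge 0$ denotes the arity of a symbol. For a set $X$, $\beta X$ is the space of ultrafilters over $X$ with basic open sets $\{\mathfrak u: A\in\mathfrak u\}$, $A\subseteq X$; a point $a\in X$ is identified with the principal ultrafilter it generates. For $\mathfrak u\in\beta X$, $(\forall^{\mathfrak u}x)\,\varphi(x)$ means $\{x:\varphi(x)\}\in\mathfrak u$. For a map $h:X\to Y$ into a compact Hausdorff space, $\widetilde h:\beta X\to Y$ is its continuous extension. For $F:X^n\to X$ and $R\subseteq X^n$ let $$\widetilde F(\mathfrak u_1,\dots,\mathfrak u_n)=\{A\subseteq X:(\forall^{\mathfrak u_1}x_1)\dots(\forall^{\mathfrak u_n}x_n)\,F(x_1,\dots,x_n)\in A\},$$ $$\widetilde R=\{(\mathfrak u_1,\dots,\mathfrak u_n):(\forall^{\mathfrak u_1}x_1)\dots(\forall^{\mathfrak u_n}x_n)\,(x_1,\dots,x_n)\in R\},$$ $$R^*=\{(\mathfrak u_1,\dots,\mathfrak u_n):(\forall A_1\in\mathfrak u_1)\dots(\forall A_n\in\mathfrak u_n)\;(A_1\times\dots\times A_n)\cap R\neq\emptyset\}.$$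 For an ordinary model $\mathfrak A=(X,F,\dots,R,\dots)$ put $\widetilde{\mathfrak A}=(\beta X,\widetilde F,\dots,\widetilde R,\dots)$ and $\mathfrak A^*=(\beta X,\widetilde F,\dots,R^*,\dots)$. A \emph{narrow-sense generalized model} $\mathfrak B=(\beta X,\mathfrak f,\dots,\mathfrak r,\dots)$ interprets $n$-ary functional and predicate symbols by ultrafilters $\mathfrak f\in\beta(X^{X^n})$ and $\mathfrak r\in\beta\,\mathcal P(X^n)$. It is \emph{pseudo-principal on functional symbols} if for every such $\mathfrak f$ and all $a_1,\dots,a_n\in X$ the ultrafilter $\{A\subseteq X:(\forall^{\mathfrak f}\varphi)\,\varphi(a_1,\dots,a_n)\in A\}$ is principal. Its \emph{principal submodel} is then the ordinary model on $X$ in which the operation interpreting the symbol sends $(a_1,\dots,a_n)$ to the point generating this ultrafilter, and a predicate symbol with ultrafilter $\mathfrak r$ holds at $(a_1,\dots,a_n)$ iff $(\forall^{\mathfrak r}R)\,(a_1,\dots,a_n)\in R$. A \emph{wide-sense generalized model} with universe $Z$ interprets $n$-ary symbols by ultrafilters over $Z^{Z^n}$ and over $\mathcal P(Z^n)$. The wide-sense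 model $i(\mathfrak B)$ on $\beta X$ interprets the symbols by the images of the ultrafilters $\mathfrak f,\mathfrak r$ of $\mathfrak B$ under the maps $\varphi\mapsto\widetilde\varphi$ and $R\mapsto\widetilde R$. An ordinary model is regarded as a wide-sense model by interpreting each symbol by the principal ultrafilter given by its interpretation; its limit is the model itself. For $D\subseteq Z$, $Z$ a topological space, an operation $F:Z^n\to Z$ is \emph{right continuous w.r.t.\ $D$} if for all $1\le k\le n$, $a_1,\dots,a_{k-1}\in D$ and $x_{k+1},\dots,x_n\in Z$ the map $x\mapsto F(a_1,\dots,a_{k-1},x,x_{k+1},\dots,x_n)$ is continuous. A relation $S\subseteq Z^n$ is \emph{right closed} (\emph{right clopen}) \emph{w.r.t.\ $D$} if all sets $\{x:(a_1,\dots,a_{k-1},x,x_{k+1},\dots,x_n)\in S\}$, with the same parameters, are closed (clopen). If $C$ is a subset of a topological space $T$, an ultrafilter over $T$ \emph{has the limit $p$ in $C$} if $p$ is the only point of $C$ to which it converges. Limits of a wide-sense model are formed symbol by symbol and are ordinary models; a map is a \emph{homomorphism} $\mathfrak U\to\mathfrak V$ of wide-sense models if both limits exist and it is a homomorphism $\lim\mathfrak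 U\to\lim\mathfrak V$ of ordinary models (commuting with operations and sending related tuples to related tuples). For $i(\mathfrak B)$ the limits are taken in the sets of operations right continuous, and of relations right clopen, w.r.t.\ $X$ on $\beta X$, in the topologies of pointwise convergence on $X^n$ (relations being identified with characteristic functions into the discrete space $\{0,1\}$). \textbf{Theorem.} Let $\mathfrak U=i(\mathfrak B)$, where $\mathfrak B$ is a narrow-sense generalized model with universe $\beta X$ that is pseudo-principal on functional symbols, and let $\mathfrak A$ be its principal submodel. Let $Y$ be a compact Hausdorff space, $h:X\to Y$ a map, and let $\mathfrak V$ be a wide-sense generalized model with universe $Y$ in the same signature, where each $Y^{Y^n}$ and each $\mathcal P(Y^n)$ carries some fixed topology. Suppose that the ultrafilter interpreting each $n$-ary functional symbol in $\mathfrak V$ has a limit in the set of $n$-ary operations on $Y$ right continuous w.r.t.\ $h``X=\{h(x):x\in X\}$, and that the ultrafilter interpreting each $n$-ary predicate symbol in $\mathfrak V$ has a limit in the set of $n$-ary relations on $Y$ right closed w.r.t.\ $h``X$; $\lim\mathfrak V$ is formed by these limits. Then the following are equivalent: \begin{enumerate} \item[(i)] $h$ is a homomorphism of $\mathfrak A$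 into $\mathfrak V$; \item[(ii)] $\widetilde h$ is a homomorphism of $\mathfrak U$ into $\mathfrak V$; \item[(iii)] $\widetilde h$ is a homomorphism of $\widetilde{\mathfrak A}$ into $\mathfrak V$. \end{enumerate} If, moreover, the ultrafilter interpreting each $n$-ary predicate symbol in $\mathfrak V$ has a limit in the set of subsets of $Y^n$ closed in the product topology, then each of (i)--(iii) is also equivalent to \begin{enumerate} \item[(iv)] $\widetilde h$ is a homomorphism of $\mathfrak A^*$ into $\mathfrak V$. \end{enumerate} -/

import Mathlib

universe u v w w'

/-!
The space of ultrafilters over a set `X` is Mathlib's `Ultrafilter X` with its standard topology,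
whose basic open sets are `{u | A ∈ u}`; a point `a` of `X` is identified with the principal
ultrafilter `pure a`.  The continuous extension of a map `h : X → Y` into a compact Hausdorff space
is `Ultrafilter.extend h`.  Ordinary models are Mathlib's `L.Structure X`.
-/

namespace UltraModel

/-! ### Ultrafilter extensions of operations, relations and ordinary models -/

section Extensions

variable {X : Type u}

/-- The iterated product of a finite sequence of ultrafilters: the extension to ultrafilters of the
operation of taking `n`-tuples.  A set `A` belongs to it iff
`(∀^{u 0} x₀) … (∀^{u (n-1)} xₙ₋₁), (x₀, …, xₙ₋₁) ∈ A`. -/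
def tensor : {n : ℕ} → (Fin n → Ultrafilter X) → Ultrafilter (Fin n → X)
  | 0, _ => pure Fin.elim0
  | _ + 1, u => (u 0).bind fun x => (tensor (Fin.tail u)).map (Fin.cons x)

theorem mem_tensor_zero (u : Fin 0 → Ultrafilter X) (A : Set (Fin 0 → X)) :
    A ∈ tensor u ↔ Fin.elim0 ∈ A := Iff.rfl

theorem mem_tensor_succ {n : ℕ} (u : Fin (n + 1) → Ultrafilter X) (A : Set (Fin (n + 1) → X)) :
    A ∈ tensor u ↔ ∀ᶠ x in (u 0 : Filter X),
      ∀ᶠ y in (tensor (Fin.tail u) : Filter (Fin n → X)),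
        (Fin.cons x y : Fin (n + 1) → X) ∈ A := Iff.rfl

/-- The ultrafilter extension of an `n`-ary operation:
`A ∈ tildeOp F u` iff `(∀^{u 0} x₀) … (∀^{u (n-1)} xₙ₋₁), F (x₀, …, xₙ₋₁) ∈ A`. -/
def tildeOp {n : ℕ} (F : (Fin n → X) → X) (u : Fin n → Ultrafilter X) : Ultrafilter X :=
  (tensor u).map F

/-- The smaller ultrafilter extension of an `n`-ary relation:
`u ∈ tildeRel R` iff `(∀^{u 0} x₀) … (∀^{u (n-1)} xₙ₋₁), (x₀, …, xₙ₋₁) ∈ R`. -/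
def tildeRel {n : ℕ} (R : Set (Fin n → X)) : Set (Fin n → Ultrafilter X) :=
  {u | R ∈ tensor u}

/-- The larger ultrafilter extension of an `n`-ary relation. -/
def starRel {n : ℕ} (R : Set (Fin n → X)) : Set (Fin n → Ultrafilter X) :=
  {u | ∀ A : Fin n → Set X, (∀ k, A k ∈ u k) → ∃ x : Fin n → X, (∀ k, x k ∈ A k) ∧ x ∈ R}

variable {L : FirstOrder.Language.{w, w'}}

/-- The extension of an ordinary model with universe `X` by the smaller extensions of relations. -/
def tildeModel (𝔄 : L.Structure X) : L.Structure (Ultrafilter X) where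
  funMap f := tildeOp fun x => 𝔄.funMap f x
  RelMap R u := u ∈ tildeRel {x | 𝔄.RelMap R x}

/-- The extension of an ordinary model with universe `X` by the larger extensions of relations. -/
def starModel (𝔄 : L.Structure X) : L.Structure (Ultrafilter X) where
  funMap f := tildeOp fun x => 𝔄.funMap f x
  RelMap R u := u ∈ starRel {x | 𝔄.RelMap R x}

end Extensions

/-! ### Generalized models in the narrow sense -/

/-- A generalized model in the narrow sense, with universe `Ultrafilter X`: symbols are interpreted
by ultrafilters over the sets of operations and of relations on `X`. -/
structure NarrowModel (L : FirstOrder.Language.{w, w'}) (X : Type u) where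
  op : {n : ℕ} → L.Functions n → Ultrafilter ((Fin n → X) → X)
  rel : {n : ℕ} → L.Relations n → Ultrafilter (Set (Fin n → X))

section Narrow

variable {X : Type u}

/-- The ultrafilter extension of the application map `(x₀, …, xₙ₋₁, φ) ↦ φ (x₀, …, xₙ₋₁)`:
`A ∈ appTilde u 𝔣` iff `(∀^{u 0} x₀) … (∀^{u (n-1)} xₙ₋₁) (∀^𝔣 φ), φ (x₀, …, xₙ₋₁) ∈ A`. -/
def appTilde {n : ℕ} (u : Fin n → Ultrafilter X) (𝔣 : Ultrafilter ((Fin n → X) → X)) :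
    Ultrafilter X :=
  (tensor u).bind fun x => 𝔣.map fun φ => φ x

/-- The (smaller) ultrafilter extension of the membership predicate `(x₀, …, xₙ₋₁) ∈ R`:
it holds iff `(∀^{u 0} x₀) … (∀^{u (n-1)} xₙ₋₁) (∀^𝔯 R), (x₀, …, xₙ₋₁) ∈ R`. -/
def inTilde {n : ℕ} (u : Fin n → Ultrafilter X) (𝔯 : Ultrafilter (Set (Fin n → X))) : Prop :=
  ∀ᶠ x in (tensor u : Filter (Fin n → X)), ∀ᶠ R in (𝔯 : Filter (Set (Fin n → X))), x ∈ R

/-- An ultrafilter over the set of `n`-ary operations is pseudo-principal if the extended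
application map takes it, together with principal ultrafilters, to principal ultrafilters. -/
def IsPseudoPrincipal {n : ℕ} (𝔣 : Ultrafilter ((Fin n → X) → X)) : Prop :=
  ∀ a : Fin n → X, ∃ b : X, appTilde (fun k => pure (a k)) 𝔣 = pure b

variable {L : FirstOrder.Language.{w, w'}}

/-- The interpretation is pseudo-principal on functional symbols. -/
def NarrowModel.PseudoPrincipal (𝔅 : NarrowModel L X) : Prop :=
  ∀ {n : ℕ} (f : L.Functions n), IsPseudoPrincipal (𝔅.op f)

/-- The principal submodel, whose universe is the set of principal ultrafilters, identified
with `X`. -/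
noncomputable def NarrowModel.principalSubmodel (𝔅 : NarrowModel L X) (h𝔅 : 𝔅.PseudoPrincipal) :
    L.Structure X where
  funMap f a := (h𝔅 f a).choose
  RelMap R a := inTilde (fun k => pure (a k)) (𝔅.rel R)

theorem NarrowModel.pure_funMap_principalSubmodel (𝔅 : NarrowModel L X) (h𝔅 : 𝔅.PseudoPrincipal)
    {n : ℕ} (f : L.Functions n) (a : Fin n → X) :
    pure ((𝔅.principalSubmodel h𝔅).funMap f a) = appTilde (fun k => pure (a k)) (𝔅.op f) :=
  (h𝔅 f a).choose_spec.symm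

end Narrow

/-! ### Generalized models in the wide sense -/

/-- A generalized model in the wide sense, with universe `Z`: symbols are interpreted by
ultrafilters over the sets of operations and of relations on `Z` itself. -/
structure WideModel (L : FirstOrder.Language.{w, w'}) (Z : Type u) where
  op : {n : ℕ} → L.Functions n → Ultrafilter ((Fin n → Z) → Z)
  rel : {n : ℕ} → L.Relations n → Ultrafilter (Set (Fin n → Z))

/-- The identification map `i` on models.  The ultrafilter `i(𝔣)` is generated by the sets
`{φ̃ : φ ∈ A}` with `A ∈ 𝔣`, and `i(𝔯)` by the sets `{R̃ : R ∈ A}` with `A ∈ 𝔯`. -/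
def NarrowModel.toWide {L : FirstOrder.Language.{w, w'}} {X : Type u} (𝔅 : NarrowModel L X) :
    WideModel L (Ultrafilter X) where
  op f := (𝔅.op f).map tildeOp
  rel R := (𝔅.rel R).map tildeRel

/-- An ordinary model as a generalized model in the wide sense with principal interpretation. -/
def WideModel.ofModel {L : FirstOrder.Language.{w, w'}} {Z : Type u} (𝔄 : L.Structure Z) : WideModel L Z where
  op f := pure fun x => 𝔄.funMap f x
  rel R := pure {x | 𝔄.RelMap R x}

/-- `a` is the limit of the ultrafilter `𝔲` in the set `C` of points of the topological space
`(α, t)`: the only point of `C` to which `𝔲` converges. -/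
def IsLimitIn {α : Type u} (t : TopologicalSpace α) (C : Set α) (𝔲 : Ultrafilter α) (a : α) :
    Prop :=
  a ∈ C ∧ (𝔲 : Filter α) ≤ @nhds α t a ∧ ∀ b ∈ C, (𝔲 : Filter α) ≤ @nhds α t b → b = a

/-- The data with respect to which limits of generalized models with universe `Z` are taken:
topologies on the sets of `n`-ary operations and of `n`-ary relations on `Z`, and the sets of
operations and of relations in which the limits are taken. -/
structure LimitSpaces (Z : Type u) where
  opTop : (n : ℕ) → TopologicalSpace ((Fin n → Z) → Z)
  relTop : (n : ℕ) → TopologicalSpace (Set (Fin n → Z))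
  ops : (n : ℕ) → Set ((Fin n → Z) → Z)
  rels : (n : ℕ) → Set (Set (Fin n → Z))

/-- The ordinary model `𝔐` is the limit of the generalized model `𝔘`. -/
def WideModel.IsLimit {L : FirstOrder.Language.{w, w'}} {Z : Type u} (𝔘 : WideModel L Z) (T : LimitSpaces Z)
    (𝔐 : L.Structure Z) : Prop :=
  (∀ (n : ℕ) (f : L.Functions n),
    IsLimitIn (T.opTop n) (T.ops n) (𝔘.op f) fun x => 𝔐.funMap f x) ∧
  ∀ (n : ℕ) (R : L.Relations n),
    IsLimitIn (T.relTop n) (T.rels n) (𝔘.rel R) {x | 𝔐.RelMap R x}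

/-- `g` is a homomorphism of ordinary models. -/
def IsModelHom {L : FirstOrder.Language.{w, w'}} {Z : Type u} {Y : Type v} (𝔐 : L.Structure Z)
    (𝔑 : L.Structure Y) (g : Z → Y) : Prop :=
  ∃ φ : @FirstOrder.Language.Hom L Z Y 𝔐 𝔑, φ.toFun = g

/-- `g` is a homomorphism of generalized models in the wide sense: a homomorphism of `lim 𝔘` into
`lim 𝔙`.  (Limits are unique.) -/
def IsWideHom {L : FirstOrder.Language.{w, w'}} {Z : Type u} {Y : Type v} (S : LimitSpaces Z)
    (𝔘 : WideModel L Z) (T : LimitSpaces Y) (𝔙 : WideModel L Y) (g : Z → Y) : Prop :=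
  ∃ (𝔐 : L.Structure Z) (𝔑 : L.Structure Y), 𝔘.IsLimit S 𝔐 ∧ 𝔙.IsLimit T 𝔑 ∧ IsModelHom 𝔐 𝔑 g

/-- The limit spaces used for ordinary models: all operations and all relations, discrete. -/
def LimitSpaces.discrete (Z : Type u) : LimitSpaces Z where
  opTop _ := ⊥
  relTop _ := ⊥
  ops _ := Set.univ
  rels _ := Set.univ

/-- The limit of an ordinary model, regarded as a generalized one, is the model itself. -/
theorem WideModel.ofModel_isLimit_iff {L : FirstOrder.Language.{w, w'}} {Z : Type u} (𝔄 𝔐 : L.Structure Z) :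
    (WideModel.ofModel 𝔄).IsLimit (LimitSpaces.discrete Z) 𝔐 ↔ 𝔐 = 𝔄 := by
  have key : ∀ {α : Type u} (a b : α),
      IsLimitIn (⊥ : TopologicalSpace α) Set.univ (pure a) b ↔ b = a := by
    intro α a b
    let _ : TopologicalSpace α := ⊥
    have _ : DiscreteTopology α := ⟨rfl⟩
    have e : ∀ c : α, ((pure a : Ultrafilter α) : Filter α) ≤ @nhds α ⊥ c ↔ a = c := by
      intro c
      rw [nhds_discrete, Ultrafilter.coe_pure, Filter.pure_le_iff]
      exact ⟨fun h => h {c} (Filter.mem_pure.2 rfl), fun h s hs => h ▸ hs⟩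
    constructor
    · rintro ⟨-, h, -⟩
      exact ((e b).1 h).symm
    · rintro rfl
      exact ⟨trivial, (e b).2 rfl, fun c _ hc => ((e c).1 hc).symm⟩
  constructor
  · rintro ⟨h₁, h₂⟩
    obtain ⟨F, R⟩ := 𝔐
    obtain ⟨F', R'⟩ := 𝔄
    congr 1
    · funext n f
      exact (key _ _).1 (h₁ n f)
    · funext n r x
      exact congrArg (fun A : Set (Fin n → Z) => x ∈ A) ((key _ _).1 (h₂ n r))
  · rintro rfl
    exact ⟨fun n f => (key _ _).2 rfl, fun n r => (key _ _).2 rfl⟩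

/-! ### Right topological notions and the pointwise convergence topology -/

section Right

variable {Z : Type u} [TopologicalSpace Z]

/-- The set of `n`-ary operations on `Z` that are right continuous w.r.t. `D`. -/
def rightContinuousOps (D : Set Z) (n : ℕ) : Set ((Fin n → Z) → Z) :=
  {F | ∀ (i : Fin n) (x : Fin n → Z), (∀ j < i, x j ∈ D) →
    Continuous fun z : Z => F (Function.update x i z)}

/-- The set of `n`-ary relations on `Z` that are right closed w.r.t. `D`. -/
def rightClosedRels (D : Set Z) (n : ℕ) : Set (Set (Fin n → Z)) :=
  {R | ∀ (i : Fin n) (x : Fin n → Z), (∀ j < i, x j ∈ D) →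
    IsClosed {z : Z | Function.update x i z ∈ R}}

/-- The set of `n`-ary relations on `Z` that are right clopen w.r.t. `D`. -/
def rightClopenRels (D : Set Z) (n : ℕ) : Set (Set (Fin n → Z)) :=
  {R | ∀ (i : Fin n) (x : Fin n → Z), (∀ j < i, x j ∈ D) →
    IsClopen {z : Z | Function.update x i z ∈ R}}

/-- The `D`-pointwise convergence topology on the set of `n`-ary operations on `Z`. -/
@[reducible]
def pointwiseOpTop (D : Set Z) (n : ℕ) : TopologicalSpace ((Fin n → Z) → Z) :=
  TopologicalSpace.generateFrom
    {O | ∃ (a : Fin n → Z) (B : Set Z), (∀ k, a k ∈ D) ∧ IsOpen B ∧ O = {F | F a ∈ B}}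

end Right

/-- The `D`-pointwise convergence topology on the set of `n`-ary relations on `Z`, identified with
their characteristic functions into the discrete two-point space. -/
@[reducible]
def pointwiseRelTop {Z : Type u} (D : Set Z) (n : ℕ) : TopologicalSpace (Set (Fin n → Z)) :=
  TopologicalSpace.generateFrom
    {O | ∃ a : Fin n → Z, (∀ k, a k ∈ D) ∧ (O = {R | a ∈ R} ∨ O = {R | a ∉ R})}

/-- The limit spaces used for the images of models in the narrow sense: right continuous operations
and right clopen relations w.r.t. the set of principal ultrafilters, with the topologies of pointwise
convergence on principal ultrafilters. -/
def LimitSpaces.ultrafilter (X : Type u) : LimitSpaces (Ultrafilter X) where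
  opTop := pointwiseOpTop (Set.range pure)
  relTop := pointwiseRelTop (Set.range pure)
  ops := rightContinuousOps (Set.range pure)
  rels := rightClopenRels (Set.range pure)

/-- The limit spaces consisting of right continuous operations and right closed relations w.r.t. `D`,
with given topologies on the sets of all operations and relations. -/
def LimitSpaces.right {Y : Type v} [TopologicalSpace Y] (D : Set Y)
    (τ : (n : ℕ) → TopologicalSpace ((Fin n → Y) → Y))
    (ρ : (n : ℕ) → TopologicalSpace (Set (Fin n → Y))) : LimitSpaces Y where
  opTop := τ
  relTop := ρ
  ops := rightContinuousOps D
  rels := rightClosedRels D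

end UltraModel

open UltraModel

namespace UltraModel

/-! ### Iterated products of ultrafilters -/

section Tensor

variable {X : Type u}

/-! Everything rests on a density principle for principal tuples (`tildeRel_subset_of_rightClosed`).
If a relation `S` on ultrafilters is right closed w.r.t. principal points and contains the principal
tuples of `R`, then it contains `tildeRel R`. Indeed, for `u ∈ tildeRel R` and `u 0`-almost every
`x`, induction puts `(pure x, u 1, …)` in `S`, and `pure x` tends to `u 0` along `u 0`. Only
coordinates to the left of the moving one need be principal, which is what right closedness allows.
With `R` everything, right continuous operations (or right clopen relations) that agree on principal
tuples agree everywhere.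

This identifies the limit of `𝔅.toWide` (`NarrowModel.toWide_isLimit`): pointwise convergence only
tests principal tuples, where it prescribes the values of the principal submodel, so (ii) and (iii)
concern the same model. For (i) and (iii), restrict the extended map to principal points;
conversely, pull the operations and relations of `lim 𝔙` back along it and apply the principle. For
(iv), `starRel R` is the closure of the principal tuples of `R`, so closed relations and continuity
of the extended map suffice. -/

theorem update_succ_eq_cons {n : ℕ} {α : Type u} (x : Fin (n + 1) → α) (i : Fin n) (z : α) :
    Function.update x i.succ z = Fin.cons (x 0) (Function.update (Fin.tail x) i z) := by
  conv_lhs => rw [← Fin.cons_self_tail x]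
  rw [Fin.cons_update]

theorem mem_tensor_pure {n : ℕ} (a : Fin n → X) (A : Set (Fin n → X)) :
    A ∈ tensor (fun k => pure (a k)) ↔ a ∈ A := by
  induction n with
  | zero => rw [mem_tensor_zero, Subsingleton.elim a Fin.elim0]
  | succ n ih =>
    rw [mem_tensor_succ, Ultrafilter.coe_pure, Filter.eventually_pure]
    refine (ih (Fin.tail a) {y | (Fin.cons (a 0) y : Fin (n + 1) → X) ∈ A}).trans ?_
    rw [Set.mem_ofPred_eq, Fin.cons_self_tail]

theorem tensor_pure {n : ℕ} (a : Fin n → X) : tensor (fun k => pure (a k)) = pure a :=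
  Ultrafilter.ext fun A => by rw [mem_tensor_pure, Ultrafilter.mem_pure]

theorem tildeOp_pure {n : ℕ} (F : (Fin n → X) → X) (a : Fin n → X) :
    tildeOp F (fun k => pure (a k)) = pure (F a) := by
  rw [tildeOp, tensor_pure, Ultrafilter.map_pure]

theorem pure_mem_tildeRel {n : ℕ} (R : Set (Fin n → X)) (a : Fin n → X) :
    (fun k => pure (a k)) ∈ tildeRel R ↔ a ∈ R :=
  mem_tensor_pure a R

theorem pure_mem_starRel {n : ℕ} (R : Set (Fin n → X)) (a : Fin n → X) :
    (fun k => pure (a k)) ∈ starRel R ↔ a ∈ R := by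
  constructor
  · intro H
    obtain ⟨x, hx, hR⟩ := H (fun k => {a k}) fun k => Ultrafilter.mem_pure.2 rfl
    rwa [← (funext hx : x = a)]
  · exact fun H A hA => ⟨a, fun k => Ultrafilter.mem_pure.1 (hA k), H⟩

theorem exists_eq_pure {n : ℕ} {a : Fin n → Ultrafilter X} (ha : ∀ k, a k ∈ Set.range pure) :
    ∃ b : Fin n → X, a = fun k => pure (b k) := by
  choose b hb using ha
  exact ⟨b, funext fun k => (hb k).symm⟩

/-- Principal coordinates on the left merely evaluate the leading quantifiers, replacing `R` by a
section. The varying coordinate then comes first, and the condition on it says that a fixed set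
belongs to it: a basic clopen set. -/
theorem tildeRel_mem_rightClopenRels {n : ℕ} (R : Set (Fin n → X)) :
    tildeRel R ∈ rightClopenRels (Set.range (pure : X → Ultrafilter X)) n := by
  induction n with
  | zero => exact fun i => i.elim0
  | succ n ih =>
    intro i x hx
    cases i using Fin.cases with
    | zero =>
      have e : {z | Function.update x 0 z ∈ tildeRel R} =
          {z : Ultrafilter X | {a | {y | (Fin.cons a y : Fin (n + 1) → X) ∈ R} ∈
            tensor (Fin.tail x)} ∈ z} := by
        ext z
        change R ∈ tensor (Function.update x 0 z) ↔ _
        rw [mem_tensor_succ, Function.update_self, Fin.tail_update_zero]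
        rfl
      rw [e]
      exact ⟨ultrafilter_isClosed_basic _, ultrafilter_isOpen_basic _⟩
    | succ i =>
      obtain ⟨a, ha⟩ := hx 0 (Fin.succ_pos i)
      have e : {z | Function.update x i.succ z ∈ tildeRel R} =
          {z : Ultrafilter X | Function.update (Fin.tail x) i z ∈
            tildeRel {y | (Fin.cons a y : Fin (n + 1) → X) ∈ R}} := by
        ext z
        change R ∈ tensor (Function.update x i.succ z) ↔ _
        rw [mem_tensor_succ, update_succ_eq_cons, Fin.cons_zero, Fin.tail_cons, ← ha,
          Ultrafilter.coe_pure, Filter.eventually_pure]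
        rfl
      rw [e]
      exact ih _ i (Fin.tail x) fun j hj => hx j.succ (Fin.succ_lt_succ_iff.2 hj)

/-- The preimage under `tildeOp F` of the basic open set given by `A` is `tildeRel (F ⁻¹' A)`. -/
theorem tildeOp_mem_rightContinuousOps {n : ℕ} (F : (Fin n → X) → X) :
    tildeOp F ∈ rightContinuousOps (Set.range (pure : X → Ultrafilter X)) n := by
  intro i x hx
  refine continuous_generateFrom_iff.2 ?_
  rintro _ ⟨A, rfl⟩
  exact (tildeRel_mem_rightClopenRels (F ⁻¹' A) i x hx).isOpen

/-- A right closed relation containing the principal tuples of `R` contains the extension of `R`. -/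
theorem tildeRel_subset_of_rightClosed {n : ℕ} {R : Set (Fin n → X)}
    {S : Set (Fin n → Ultrafilter X)}
    (hS : S ∈ rightClosedRels (Set.range (pure : X → Ultrafilter X)) n)
    (hR : ∀ a ∈ R, (fun k => pure (a k)) ∈ S) : tildeRel R ⊆ S := by
  induction n with
  | zero =>
    intro u hu
    rw [Subsingleton.elim u fun k => pure ((Fin.elim0 : Fin 0 → X) k)]
    exact hR _ hu
  | succ n ih =>
    intro u hu
    have key : {x : X | (Fin.cons (pure x) (Fin.tail u) : Fin (n + 1) → Ultrafilter X) ∈ S} ∈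
        u 0 := by
      refine Filter.mem_of_superset ((mem_tensor_succ u R).1 hu) fun x hx => ?_
      refine ih (R := {y | (Fin.cons x y : Fin (n + 1) → X) ∈ R})
        (S := {v | (Fin.cons (pure x) v : Fin (n + 1) → Ultrafilter X) ∈ S}) ?_ ?_ hx
      -- The frozen first coordinate `pure x` is principal, so right closedness passes to this
      -- section of `S`.
      · intro i v hv
        have := hS i.succ (Fin.cons (pure x) v) fun j hj => by
          cases j using Fin.cases with
          | zero => exact ⟨x, rfl⟩
          | succ j => exact hv j (Fin.succ_lt_succ_iff.1 hj)
        simp only [update_succ_eq_cons, Fin.cons_zero, Fin.tail_cons] at this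
        exact this
      · intro y hy
        have := hR _ hy
        have e : (fun k => pure ((Fin.cons x y : Fin (n + 1) → X) k)) =
            (Fin.cons (pure x) fun k => pure (y k) : Fin (n + 1) → Ultrafilter X) := by
          funext k
          cases k using Fin.cases <;> rfl
        rwa [e] at this
    have hcl := hS 0 u fun j hj => (Fin.not_lt_zero j hj).elim
    have hmem : u 0 ∈ {z | Function.update u 0 z ∈ S} := by
      -- The section of `S` in the first coordinate is closed and contains `pure x` for `u 0`-almost
      -- all `x`, hence contains their limit `u 0`.
      refine hcl.mem_of_tendsto (Ultrafilter.tendsto_pure_self (u 0)) ?_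
      refine Filter.mem_of_superset key fun x hx => ?_
      change Function.update u 0 (pure x) ∈ S
      rw [← Fin.cons_self_tail u, Fin.update_cons_zero]
      exact hx
    simpa using hmem

/-- Used to propagate identities: `S` will be the set of tuples where two operations or relations
agree. -/
theorem mem_of_rightClosed {n : ℕ} {S : Set (Fin n → Ultrafilter X)}
    (hS : S ∈ rightClosedRels (Set.range (pure : X → Ultrafilter X)) n)
    (hR : ∀ a : Fin n → X, (fun k => pure (a k)) ∈ S) (u : Fin n → Ultrafilter X) : u ∈ S :=
  tildeRel_subset_of_rightClosed (R := Set.univ) hS (fun a _ => hR a)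
    (Filter.univ_mem : Set.univ ∈ (tensor u : Filter (Fin n → X)))

end Tensor

/-! ### Limits of generalized models -/

section Limits

variable {L : FirstOrder.Language.{w, w'}}

theorem WideModel.IsLimit.unique {Z : Type u} {𝔘 : WideModel L Z} {T : LimitSpaces Z}
    {𝔐 𝔑 : L.Structure Z} (h𝔐 : 𝔘.IsLimit T 𝔐) (h𝔑 : 𝔘.IsLimit T 𝔑) : 𝔐 = 𝔑 := by
  obtain ⟨F, R⟩ := 𝔐
  obtain ⟨F', R'⟩ := 𝔑
  congr 1
  · funext n f
    exact (h𝔑.1 n f).2.2 _ (h𝔐.1 n f).1 (h𝔐.1 n f).2.1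
  · funext n r x
    exact congrArg (fun A : Set (Fin n → Z) => x ∈ A)
      ((h𝔑.2 n r).2.2 _ (h𝔐.2 n r).1 (h𝔐.2 n r).2.1)

theorem isWideHom_iff {Z : Type u} {Y : Type v} {S : LimitSpaces Z} {𝔘 : WideModel L Z}
    {T : LimitSpaces Y} {𝔙 : WideModel L Y} {𝔐 : L.Structure Z} {𝔑 : L.Structure Y}
    (h𝔐 : 𝔘.IsLimit S 𝔐) (h𝔑 : 𝔙.IsLimit T 𝔑) (g : Z → Y) :
    IsWideHom S 𝔘 T 𝔙 g ↔ IsModelHom 𝔐 𝔑 g := by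
  constructor
  · rintro ⟨𝔐', 𝔑', h₁, h₂, hg⟩
    rwa [h₁.unique h𝔐, h₂.unique h𝔑] at hg
  · exact fun hg => ⟨𝔐, 𝔑, h𝔐, h𝔑, hg⟩

theorem isModelHom_iff {Z : Type u} {Y : Type v} (𝔐 : L.Structure Z) (𝔑 : L.Structure Y)
    (g : Z → Y) : IsModelHom 𝔐 𝔑 g ↔
      (∀ (n : ℕ) (f : L.Functions n) (x : Fin n → Z), g (𝔐.funMap f x) = 𝔑.funMap f (g ∘ x)) ∧
      ∀ (n : ℕ) (R : L.Relations n) (x : Fin n → Z), 𝔐.RelMap R x → 𝔑.RelMap R (g ∘ x) := by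
  constructor
  · rintro ⟨φ, rfl⟩
    exact ⟨fun n f x => φ.map_fun' f x, fun n R x => φ.map_rel' R x⟩
  · rintro ⟨h₁, h₂⟩
    exact ⟨@FirstOrder.Language.Hom.mk L Z Y 𝔐 𝔑 g (fun {n} => h₁ n) (fun {n} => h₂ n), rfl⟩

variable {X : Type u}

theorem appTilde_pure {n : ℕ} (a : Fin n → X) (𝔣 : Ultrafilter ((Fin n → X) → X)) :
    appTilde (fun k => pure (a k)) 𝔣 = 𝔣.map fun φ => φ a := by
  rw [appTilde, tensor_pure]
  exact Ultrafilter.ext fun A => Iff.rfl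

theorem inTilde_pure {n : ℕ} (a : Fin n → X) (𝔯 : Ultrafilter (Set (Fin n → X))) :
    inTilde (fun k => pure (a k)) 𝔯 ↔ ∀ᶠ R in (𝔯 : Filter (Set (Fin n → X))), a ∈ R := by
  rw [inTilde, tensor_pure, Ultrafilter.coe_pure, Filter.eventually_pure]

/-- Convergence of ultrafilters of operations in the pointwise topology on principal tuples. -/
theorem map_tildeOp_le_nhds_iff {n : ℕ} (𝔣 : Ultrafilter ((Fin n → X) → X))
    (G : (Fin n → Ultrafilter X) → Ultrafilter X) :
    ((𝔣.map tildeOp : Ultrafilter _) : Filter ((Fin n → Ultrafilter X) → Ultrafilter X)) ≤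
      @nhds _ (pointwiseOpTop (Set.range pure) n) G ↔
      ∀ a : Fin n → X, G (fun k => pure (a k)) = 𝔣.map fun φ => φ a := by
  rw [TopologicalSpace.nhds_generateFrom]
  simp only [le_iInf_iff, Filter.le_principal_iff]
  constructor
  · intro H a
    -- Inclusion of ultrafilters is already equality, so it suffices to test the basic open
    -- neighbourhoods of `G` at the principal tuple.
    refine (Ultrafilter.coe_le_coe.1 fun A hA => ?_).symm
    have := H {F | F (fun k => pure (a k)) ∈ {u : Ultrafilter X | A ∈ u}}
      ⟨hA, _, _, fun k => ⟨a k, rfl⟩, ultrafilter_isOpen_basic A, rfl⟩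
    change ∀ᶠ φ in (𝔣 : Filter ((Fin n → X) → X)), φ a ∈ A
    refine Filter.Eventually.mono (Ultrafilter.mem_map.1 this) fun φ hφ => ?_
    change A ∈ tildeOp φ (fun k => pure (a k)) at hφ
    rwa [tildeOp_pure] at hφ
  · rintro H _ ⟨hG, a, B, ha, hB, rfl⟩
    obtain ⟨b, rfl⟩ := exists_eq_pure ha
    have hG' : G (fun k => pure (b k)) ∈ B := hG
    rw [H b] at hG'
    -- The principal points `pure (φ b)` converge along `𝔣` to the image ultrafilter, so they
    -- eventually lie in its neighbourhood `B`.
    have h₀ := Ultrafilter.tendsto_pure_self (𝔣.map fun φ => φ b) (hB.mem_nhds hG')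
    have h₁ : ∀ᶠ φ in (𝔣 : Filter ((Fin n → X) → X)), (pure (φ b) : Ultrafilter X) ∈ B := h₀
    refine Ultrafilter.mem_map.2 (Filter.Eventually.mono h₁ fun φ hφ => ?_)
    change tildeOp φ (fun k => pure (b k)) ∈ B
    rwa [tildeOp_pure]

/-- Convergence of ultrafilters of relations in the pointwise topology on principal tuples. -/
theorem map_tildeRel_le_nhds_iff {n : ℕ} (𝔯 : Ultrafilter (Set (Fin n → X)))
    (S : Set (Fin n → Ultrafilter X)) :
    ((𝔯.map tildeRel : Ultrafilter _) : Filter (Set (Fin n → Ultrafilter X))) ≤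
      @nhds _ (pointwiseRelTop (Set.range pure) n) S ↔
      ∀ a : Fin n → X, (fun k => pure (a k)) ∈ S ↔ ∀ᶠ R in (𝔯 : Filter (Set (Fin n → X))), a ∈ R := by
  rw [TopologicalSpace.nhds_generateFrom]
  simp only [le_iInf_iff, Filter.le_principal_iff]
  constructor
  · intro H a
    constructor
    · intro ha
      have := H {R | (fun k => pure (a k)) ∈ R} ⟨ha, _, fun k => ⟨a k, rfl⟩, Or.inl rfl⟩
      exact Filter.mem_of_superset (show tildeRel ⁻¹' _ ∈ 𝔯 from this) fun R hR => (pure_mem_tildeRel R a).1 hR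
    · contrapose!
      intro ha
      have := H {R | (fun k => pure (a k)) ∉ R} ⟨ha, _, fun k => ⟨a k, rfl⟩, Or.inr rfl⟩
      change ∀ᶠ R in _, a ∉ R
      exact Filter.mem_of_superset (show tildeRel ⁻¹' _ ∈ 𝔯 from this) fun R hR h =>
        hR ((pure_mem_tildeRel R a).2 h)
  · rintro H _ ⟨hS, a, ha, rfl | rfl⟩
    · obtain ⟨b, rfl⟩ := exists_eq_pure ha
      refine Ultrafilter.mem_map.2 (Filter.Eventually.mono ((H b).1 hS) fun R hR => ?_)
      exact (pure_mem_tildeRel R b).2 hR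
    · obtain ⟨b, rfl⟩ := exists_eq_pure ha
      have h₁ := Ultrafilter.eventually_not.2 fun h => hS ((H b).2 h)
      refine Ultrafilter.mem_map.2 (Filter.Eventually.mono h₁ fun R hR h => ?_)
      exact hR ((pure_mem_tildeRel R b).1 h)

/-- The limit of the image of a pseudo-principal model is the extension of its principal
submodel. -/
theorem NarrowModel.toWide_isLimit (𝔅 : NarrowModel L X) (h𝔅 : 𝔅.PseudoPrincipal) :
    𝔅.toWide.IsLimit (LimitSpaces.ultrafilter X) (tildeModel (𝔅.principalSubmodel h𝔅)) := by
  constructor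
  · intro n f
    have hlim := (map_tildeOp_le_nhds_iff (𝔅.op f)
      (tildeOp fun x => (𝔅.principalSubmodel h𝔅).funMap f x)).2 fun a => by
        rw [tildeOp_pure, 𝔅.pure_funMap_principalSubmodel h𝔅, appTilde_pure]
    refine ⟨tildeOp_mem_rightContinuousOps _, hlim, fun G hG hG' => funext fun u => ?_⟩
    refine mem_of_rightClosed (S := {u | G u = tildeOp _ u}) ?_ ?_ u
    · exact fun i x hx => isClosed_eq (hG i x hx) (tildeOp_mem_rightContinuousOps _ i x hx)
    · intro a
      exact ((map_tildeOp_le_nhds_iff _ _).1 hG' a).trans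
        ((map_tildeOp_le_nhds_iff _ _).1 hlim a).symm
  · intro n R
    have hlim := (map_tildeRel_le_nhds_iff (𝔅.rel R)
      (tildeRel {x | (𝔅.principalSubmodel h𝔅).RelMap R x})).2 fun a => by
        rw [pure_mem_tildeRel]
        exact inTilde_pure a _
    refine ⟨tildeRel_mem_rightClopenRels _, hlim, fun S hS hS' => Set.ext fun u => ?_⟩
    refine mem_of_rightClosed (S := {u | u ∈ S ↔ u ∈ tildeRel _}) ?_ ?_ u
    · intro i x hx
      have h₁ := hS i x hx
      have h₂ := tildeRel_mem_rightClopenRels {x | (𝔅.principalSubmodel h𝔅).RelMap R x} i x hx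
      -- An equivalence is two implications, each of which needs one section open and the other
      -- closed; this is where clopenness, rather than closedness, is used.
      have e : {z | Function.update x i z ∈ {u | u ∈ S ↔ u ∈ tildeRel
          {x | (𝔅.principalSubmodel h𝔅).RelMap R x}}} =
          ({z | Function.update x i z ∈ S} ⇨ {z | Function.update x i z ∈ tildeRel
            {x | (𝔅.principalSubmodel h𝔅).RelMap R x}}) ⊓
          ({z | Function.update x i z ∈ tildeRel
            {x | (𝔅.principalSubmodel h𝔅).RelMap R x}} ⇨ {z | Function.update x i z ∈ S}) := by
        ext z
        simp [himp_eq]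
        tauto
      rw [e, himp_eq, himp_eq]
      exact ((h₂.union h₁.compl).inter (h₁.union h₂.compl)).isClosed
    · intro a
      exact ((map_tildeRel_le_nhds_iff _ _).1 hS' a).trans
        ((map_tildeRel_le_nhds_iff _ _).1 hlim a).symm

end Limits

/-! ### Extension of homomorphisms -/

section Homs

theorem rightClosedRels_of_isClosed {Y : Type v} [TopologicalSpace Y] {n : ℕ}
    {S : Set (Fin n → Y)} (hS : IsClosed S) (D : Set Y) :
    S ∈ rightClosedRels D n :=
  fun i _ _ => hS.preimage (continuous_const.update i continuous_id)

variable {L : FirstOrder.Language.{w, w'}} {X : Type u} {Y : Type v}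
  [TopologicalSpace Y] [T2Space Y]

theorem extend_comp_pure {n : ℕ} (h : X → Y) (a : Fin n → X) :
    (Ultrafilter.extend h ∘ fun k => pure (a k)) = h ∘ a :=
  funext fun k => ultrafilter_extend_pure h (a k)

theorem extend_mem_range {h : X → Y} {u : Ultrafilter X} (hu : u ∈ Set.range pure) :
    Ultrafilter.extend h u ∈ Set.range h := by
  obtain ⟨a, rfl⟩ := hu
  exact ⟨a, (ultrafilter_extend_pure h a).symm⟩

variable [CompactSpace Y]

/-- Both sides are right continuous in `u` w.r.t. principal points, since the extended map sends
these into the range of `h`. As `Y` is Hausdorff, the agreement set is right closed, and it contains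
the principal tuples. -/
theorem extend_comp_tildeOp {n : ℕ} {h : X → Y} {F : (Fin n → X) → X} {G : (Fin n → Y) → Y}
    (hG : G ∈ rightContinuousOps (Set.range h) n) (hF : ∀ a, h (F a) = G (h ∘ a))
    (u : Fin n → Ultrafilter X) :
    Ultrafilter.extend h (tildeOp F u) = G (Ultrafilter.extend h ∘ u) := by
  refine mem_of_rightClosed
    (S := {u | Ultrafilter.extend h (tildeOp F u) = G (Ultrafilter.extend h ∘ u)}) ?_ ?_ u
  · intro i x hx
    refine isClosed_eq
      ((continuous_ultrafilter_extend h).comp (tildeOp_mem_rightContinuousOps F i x hx)) ?_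
    simp only [Function.comp_update]
    exact (hG i (Ultrafilter.extend h ∘ x) fun j hj => extend_mem_range (hx j hj)).comp
      (continuous_ultrafilter_extend h)
  · intro a
    rw [Set.mem_ofPred_eq, extend_comp_pure, tildeOp_pure, ← hF]
    exact ultrafilter_extend_pure h (F a)

/-- The preimage of `S` under the extended map is right closed w.r.t. principal points, so the
density principle applies to it. -/
theorem extend_comp_mem_of_mem_tildeRel {n : ℕ} {h : X → Y} {R : Set (Fin n → X)}
    {S : Set (Fin n → Y)} (hS : S ∈ rightClosedRels (Set.range h) n)
    (hR : ∀ a ∈ R, h ∘ a ∈ S) {u : Fin n → Ultrafilter X} (hu : u ∈ tildeRel R) :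
    Ultrafilter.extend h ∘ u ∈ S := by
  refine tildeRel_subset_of_rightClosed (S := {u | Ultrafilter.extend h ∘ u ∈ S}) ?_ ?_ hu
  · intro i x hx
    simp only [Set.mem_ofPred_eq, Function.comp_update]
    exact (hS i (Ultrafilter.extend h ∘ x) fun j hj => extend_mem_range (hx j hj)).preimage
      (continuous_ultrafilter_extend h)
  · intro a ha
    rw [Set.mem_ofPred_eq, extend_comp_pure]
    exact hR a ha

theorem extend_comp_mem_of_mem_starRel {n : ℕ} {h : X → Y} {R : Set (Fin n → X)}
    {S : Set (Fin n → Y)} (hS : IsClosed S)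
    (hR : ∀ a ∈ R, h ∘ a ∈ S) {u : Fin n → Ultrafilter X} (hu : u ∈ starRel R) :
    Ultrafilter.extend h ∘ u ∈ S := by
  by_contra hc
  -- If the image tuple missed `S`, an open box around it would too. The preimages under `h` of the
  -- sides of the box belong to the `u k`, so `starRel` yields a tuple of `R` whose image lies in
  -- the box, although it is in `S`.
  obtain ⟨B, hB, hBS⟩ := isOpen_pi_iff'.1 hS.isOpen_compl _ hc
  obtain ⟨x, hx, hxR⟩ := hu (fun k => h ⁻¹' B k) fun k => by
      have hk := ultrafilter_extend_eq_iff.1 (rfl : Ultrafilter.extend h (u k) = _)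
      exact hk ((hB k).1.mem_nhds (hB k).2)
  exact hBS (fun k _ => hx k) (hR x hxR)

theorem isModelHom_tildeModel_iff (𝔄 : L.Structure X) (𝔑 : L.Structure Y) (h : X → Y)
    (hop : ∀ (n : ℕ) (f : L.Functions n),
      (fun x => 𝔑.funMap f x) ∈ rightContinuousOps (Set.range h) n)
    (hrel : ∀ (n : ℕ) (R : L.Relations n),
      {x | 𝔑.RelMap R x} ∈ rightClosedRels (Set.range h) n) :
    IsModelHom (tildeModel 𝔄) 𝔑 (Ultrafilter.extend h) ↔ IsModelHom 𝔄 𝔑 h := by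
  rw [isModelHom_iff, isModelHom_iff]
  constructor
  · rintro ⟨h₁, h₂⟩
    constructor
    · intro n f a
      have := h₁ n f fun k => pure (a k)
      rw [extend_comp_pure] at this
      rw [← this, ← ultrafilter_extend_pure h (𝔄.funMap f a)]
      exact congrArg (Ultrafilter.extend h) (tildeOp_pure _ a).symm
    · intro n R a ha
      have := h₂ n R (fun k => pure (a k)) ((pure_mem_tildeRel _ a).2 ha)
      rwa [extend_comp_pure] at this
  · rintro ⟨h₁, h₂⟩
    exact ⟨fun n f u => extend_comp_tildeOp (hop n f) (h₁ n f) u,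
      fun n R u hu => extend_comp_mem_of_mem_tildeRel (hrel n R) (h₂ n R) hu⟩

theorem isModelHom_starModel_iff (𝔄 : L.Structure X) (𝔑 : L.Structure Y) (h : X → Y)
    (hop : ∀ (n : ℕ) (f : L.Functions n),
      (fun x => 𝔑.funMap f x) ∈ rightContinuousOps (Set.range h) n)
    (hrel : ∀ (n : ℕ) (R : L.Relations n), IsClosed {x | 𝔑.RelMap R x}) :
    IsModelHom (starModel 𝔄) 𝔑 (Ultrafilter.extend h) ↔ IsModelHom 𝔄 𝔑 h := by
  rw [isModelHom_iff, isModelHom_iff]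
  constructor
  · rintro ⟨h₁, h₂⟩
    constructor
    · intro n f a
      have := h₁ n f fun k => pure (a k)
      rw [extend_comp_pure] at this
      rw [← this, ← ultrafilter_extend_pure h (𝔄.funMap f a)]
      exact congrArg (Ultrafilter.extend h) (tildeOp_pure _ a).symm
    · intro n R a ha
      have := h₂ n R (fun k => pure (a k)) ((pure_mem_starRel _ a).2 ha)
      rwa [extend_comp_pure] at this
  · rintro ⟨h₁, h₂⟩
    exact ⟨fun n f u => extend_comp_tildeOp (hop n f) (h₁ n f) u,
      fun n R u hu => extend_comp_mem_of_mem_starRel (hrel n R) (h₂ n R) hu⟩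

end Homs

end UltraModel

theorem mainTheorem1 {L : FirstOrder.Language.{w, w'}} {X : Type u} {Y : Type v}
    [TopologicalSpace Y] [CompactSpace Y] [T2Space Y]
    (𝔅 : NarrowModel L X) (h𝔅 : 𝔅.PseudoPrincipal)
    (𝔄 : L.Structure X) (h𝔄 : 𝔄 = 𝔅.principalSubmodel h𝔅)
    (𝔘 : WideModel L (Ultrafilter X)) (h𝔘 : 𝔘 = 𝔅.toWide)
    (𝔙 : WideModel L Y)
    (τ : (n : ℕ) → TopologicalSpace ((Fin n → Y) → Y))
    (ρ : (n : ℕ) → TopologicalSpace (Set (Fin n → Y)))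
    (h : X → Y)
    (hop : ∀ (n : ℕ) (f : L.Functions n),
      ∃ G, IsLimitIn (τ n) (rightContinuousOps (Set.range h) n) (𝔙.op f) G)
    (hrel : ∀ (n : ℕ) (R : L.Relations n),
      ∃ S, IsLimitIn (ρ n) (rightClosedRels (Set.range h) n) (𝔙.rel R) S) :
    [IsWideHom (LimitSpaces.discrete X) (WideModel.ofModel 𝔄)
        (LimitSpaces.right (Set.range h) τ ρ) 𝔙 h,
      IsWideHom (LimitSpaces.ultrafilter X) 𝔘
        (LimitSpaces.right (Set.range h) τ ρ) 𝔙 (Ultrafilter.extend h),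
      IsWideHom (LimitSpaces.discrete (Ultrafilter X)) (WideModel.ofModel (tildeModel 𝔄))
        (LimitSpaces.right (Set.range h) τ ρ) 𝔙 (Ultrafilter.extend h)].TFAE ∧
    ((∀ (n : ℕ) (R : L.Relations n),
        ∃ S, IsLimitIn (ρ n) {S : Set (Fin n → Y) | IsClosed S} (𝔙.rel R) S) →
      [IsWideHom (LimitSpaces.discrete X) (WideModel.ofModel 𝔄)
          (LimitSpaces.right (Set.range h) τ ρ) 𝔙 h,
        IsWideHom (LimitSpaces.ultrafilter X) 𝔘
          (LimitSpaces.right (Set.range h) τ ρ) 𝔙 (Ultrafilter.extend h),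
        IsWideHom (LimitSpaces.discrete (Ultrafilter X)) (WideModel.ofModel (tildeModel 𝔄))
          (LimitSpaces.right (Set.range h) τ ρ) 𝔙 (Ultrafilter.extend h),
        IsWideHom (LimitSpaces.discrete (Ultrafilter X)) (WideModel.ofModel (starModel 𝔄))
          (LimitSpaces.right (Set.range h) τ ρ) 𝔙 (Ultrafilter.extend h)].TFAE) := by
  subst h𝔄 h𝔘
  choose G hG using hop
  choose S hS using hrel
  let 𝔑 : L.Structure Y := ⟨fun {n} f => G n f, fun {n} R x => x ∈ S n R⟩
  have h𝔑 : 𝔙.IsLimit (LimitSpaces.right (Set.range h) τ ρ) 𝔑 := ⟨hG, hS⟩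
  have hA := isWideHom_iff ((WideModel.ofModel_isLimit_iff (𝔅.principalSubmodel h𝔅) _).2 rfl) h𝔑 h
  have hU := isWideHom_iff (𝔅.toWide_isLimit h𝔅) h𝔑 (Ultrafilter.extend h)
  have hT := isWideHom_iff
    ((WideModel.ofModel_isLimit_iff (tildeModel (𝔅.principalSubmodel h𝔅)) _).2 rfl) h𝔑
    (Ultrafilter.extend h)
  have hop' : ∀ (n : ℕ) (f : L.Functions n),
      (fun x => 𝔑.funMap f x) ∈ rightContinuousOps (Set.range h) n := fun n f => (hG n f).1
  have key := isModelHom_tildeModel_iff (𝔅.principalSubmodel h𝔅) 𝔑 h hop' fun n R => (hS n R).1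
  have h12 := hA.trans (key.symm.trans hU.symm)
  have h23 := hU.trans hT.symm
  constructor
  · tfae_have 1 ↔ 2 := h12
    tfae_have 2 ↔ 3 := h23
    tfae_finish
  · intro hcl
    have hrel' : ∀ (n : ℕ) (R : L.Relations n), IsClosed {x | 𝔑.RelMap R x} := by
      intro n R
      obtain ⟨S', hS'⟩ := hcl n R
      -- A closed relation is right closed, so the limit among closed relations competes for the
      -- limit among right closed ones and equals it by uniqueness. Hence the relations of `𝔑` are
      -- closed.
      have e : S' = S n R := (hS n R).2.2 S' (rightClosedRels_of_isClosed hS'.1 _) hS'.2.1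
      rw [e] at hS'
      exact hS'.1
    have hS := isWideHom_iff
      ((WideModel.ofModel_isLimit_iff (starModel (𝔅.principalSubmodel h𝔅)) _).2 rfl) h𝔑
      (Ultrafilter.extend h)
    have h14 := hA.trans
      ((isModelHom_starModel_iff (𝔅.principalSubmodel h𝔅) 𝔑 h hop' hrel').symm.trans hS.symm)
    tfae_have 1 ↔ 2 := h12
    tfae_have 2 ↔ 3 := h23
    tfae_have 1 ↔ 4 := h14
    tfae_finish
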